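/- Let $\mathcal X$ be a real Banach space and let $\mathcal A\subset\mathcal X\times\mathcal X$ be a (possibly nonlinear and multivalued) m-accretive operator with dense domain, i.e. $\|(x-\hat x)+\lambda(y-\hat y)\|\ge\|x-\hat x\|$ for all $(x,y),(\hat x,\hat y)\in\mathcal A$ and $\lambda\ge 0$, the range of $I+\mathcal A$ is $\mathcal X$, and $\overline{D(\mathcal A)}=\mathcal X$. Let $S(t)x=\lim_{n\to\infty}(I+\tfrac tn\mathcal A)^{-n}x$, $t\ge 0$, be the contraction semigroup generated by $\mathcal A$. Let $0<T<\infty$, $u_0\in\mathcal X$, and let $F:[0,T]\times\mathcal X\to\mathcal X$ be such that $F(\cdot,x)$ is Bochner integrable on $(0,T)$ for every $x\in\mathcal X$ and $$\|F(t,u)-F(t,v)\|\le K(t,\|u-v\|)\quad\text{for a.e. } t\in(0,T)\text{ and all }u,v\in\mathcal X,$$ where $K:[0,T]\times[0,\infty)\to[0,\infty)$ satisfies: $K(\cdot,U)$ is locally integrable on $[0,T]$ for each $U\ge 0$, $K(t,\cdot)$ is continuous and nondecreasing for a.e. $t\in(0,T)$, and $K(t,0)=0$ for all $t\in[0,T]$.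 Suppose that there are $p\in(1,\infty]$ and $\phi\in L^p(0,T)$ such that $$K(t,U)\le\phi(t)\,U\quad\text{for a.e. }t\in(0,T)\text{ and all }U\ge 0.$$ Then the operator $$\mathcal G^{u_0}u(t)=S(t)u_0+\int_0^tS(t-s)F(s,u(s))\,ds,\qquad 0\le t\le T,$$ is well defined from $C([0,T];\mathcal X)$ to $C([0,T];\mathcal X)$ (the integral being a Bochner integral), and it is a strict contraction for the norm $\sup_{0\le t\le T}e^{-\gamma t}\|u(t)\|$, i.e. it is Lipschitz for this norm with some constant $k<1$, whenever $$\gamma>\frac{p-1}{p}\,\|\phi\|_{L^p(0,T)}^{\frac p{p-1}}\ \text{ if }1<p<\infty,\qquad \gamma>\|\phi\|_{L^\infty(0,T)}\ \text{ if }p=\infty.$$ Consequently, in both cases, $\mathcal G^{u_0}$ has a unique fixed point in $C([0,T];\mathcal X)$. -/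

import Mathlib

open MeasureTheory Set Filter Topology
open scoped ENNReal

noncomputable section

namespace NonlinearCauchy

variable {X : Type*} [NormedAddCommGroup X] [NormedSpace ℝ X]

/-- A (possibly nonlinear and multivalued) operator on `X`, given by its graph `A ⊆ X × X`, is
m-accretive: `‖(x - x') + l (y - y')‖ ≥ ‖x - x'‖` for all `(x, y), (x', y') ∈ A` and `l ≥ 0`,
and the range of `I + A` is all of `X`. -/
structure IsMAccretive (A : Set (X × X)) : Prop where
  accretive : ∀ p ∈ A, ∀ q ∈ A, ∀ l : ℝ, 0 ≤ l →
    ‖p.1 - q.1‖ ≤ ‖(p.1 - q.1) + l • (p.2 - q.2)‖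
  range_eq : ∀ z : X, ∃ p ∈ A, p.1 + p.2 = z

/-- The domain `D(A) = {x | ∃ y, (x, y) ∈ A}`. -/
def domain (A : Set (X × X)) : Set X := {x | ∃ y, (x, y) ∈ A}

open Classical in
/-- The resolvent `J_l = (I + l A)⁻¹`: `resolventMap A l z` is the point `x` such that
`z ∈ x + l A x`. For m-accretive `A` and `l > 0` this `x` exists for all `z` and is unique.
Outside the range of `I + l A` (for m-accretive `A` only possible at `l = 0`) the value is `z`,
so that `J_0` is the identity. -/
def resolventMap (A : Set (X × X)) (l : ℝ) (z : X) : X :=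
  if h : ∃ x y, (x, y) ∈ A ∧ x + l • y = z then h.choose else z

/-- The nonlinear semigroup generated by `A`, by the exponential formula
`S(t) x = lim_{n → ∞} (I + (t / n) A)⁻ⁿ x`. For m-accretive `A` with dense domain in a Banach
space the limit exists for all `t ≥ 0` and all `x`. -/
def semigroup (A : Set (X × X)) (t : ℝ) (x : X) : X :=
  limUnder atTop (fun n : ℕ => (resolventMap A (t / n))^[n] x)

/-- The structural condition on the perturbation `F` with modulus `K`, on the interval `[0, T]`. -/
structure StructuralCondition (T : ℝ) (K : ℝ → ℝ → ℝ) (F : ℝ → X → X) : Prop where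
  nonneg : ∀ t ∈ Icc 0 T, ∀ U, 0 ≤ U → 0 ≤ K t U
  locallyIntegrable : ∀ U, 0 ≤ U → LocallyIntegrableOn (fun t => K t U) (Icc 0 T) volume
  continuous : ∀ᵐ t ∂(volume.restrict (Ioo 0 T)), ContinuousOn (K t) (Ici 0)
  monotone : ∀ᵐ t ∂(volume.restrict (Ioo 0 T)), MonotoneOn (K t) (Ici 0)
  map_zero : ∀ t ∈ Icc 0 T, K t 0 = 0
  bound : ∀ᵐ t ∂(volume.restrict (Ioo 0 T)), ∀ u v : X, ‖F t u - F t v‖ ≤ K t ‖u - v‖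

/-- The integrand `s ↦ S(t - s) F(s, u(s))`, for `u ∈ C([0, T]; X)`
(only its values for `0 ≤ s ≤ t ≤ T` matter). -/
def duhamelIntegrand (A : Set (X × X)) (F : ℝ → X → X) {T : ℝ} (hT : 0 ≤ T)
    (u : C(Icc (0 : ℝ) T, X)) (t s : ℝ) : X :=
  semigroup A (t - s) (F s (IccExtend hT u s))

/-- The function `t ↦ S(t) u₀ + ∫₀ᵗ S(t - s) F(s, u(s)) ds`. -/
def duhamelMap (A : Set (X × X)) (F : ℝ → X → X) {T : ℝ} (hT : 0 ≤ T) (u₀ : X)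
    (u : C(Icc (0 : ℝ) T, X)) (t : ℝ) : X :=
  semigroup A t u₀ + ∫ s in (0 : ℝ)..t, duhamelIntegrand A F hT u t s

/-- The Bielecki norm `sup_{0 ≤ t ≤ T} e^{-γ t} ‖u(t)‖` on `C([0, T]; X)`. -/
def bieleckiNorm {T : ℝ} (γ : ℝ) (u : C(Icc (0 : ℝ) T, X)) : ℝ :=
  ⨆ t : Icc (0 : ℝ) T, Real.exp (-γ * (t : ℝ)) * ‖u t‖

/-- `G` is a strict contraction of `C([0, T]; X)` for the Bielecki norm with weight `γ`. -/
def IsBieleckiContraction {T : ℝ} (γ : ℝ)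
    (G : C(Icc (0 : ℝ) T, X) → C(Icc (0 : ℝ) T, X)) : Prop :=
  ∃ k : ℝ, 0 ≤ k ∧ k < 1 ∧
    ∀ u v, bieleckiNorm γ (G u - G v) ≤ k * bieleckiNorm γ (u - v)

/-- The norm of `φ` in `L^p(0, T)` (finite, and so not a junk value, when `φ ∈ L^p(0, T)`). -/
def lpNormOn (T : ℝ) (p : ℝ≥0∞) (φ : ℝ → ℝ) : ℝ :=
  (eLpNorm φ p (volume.restrict (Ioo 0 T))).toReal

end NonlinearCauchy

end

/-! The operators `S(t)` are nonexpansive, so the difference of the images of `u` and `v` at time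
`t` is at most `∫₀ᵗ |φ(s)| ‖u(s) - v(s)‖ ds`. Bounding `‖u(s) - v(s)‖` by `e^{γs}` times the
Bielecki norm and applying Hölder with the conjugate exponent `q` gives the factor `‖φ‖_p e^{γt}
(γq)^{-1/q}`. The weight `e^{-γt}` cancels the exponential, leaving the constant `k = ‖φ‖_p
(γq)^{-1/q}`, and `k < 1` means `‖φ‖_p^q < γq`. With `q = p/(p-1)`, or `q = 1` for `p = ∞`, this is
the stated threshold (`IsMAccretive.isBieleckiContraction`).

The semigroup comes from the Crandall–Liggett theory: for `(x, y) ∈ A`, Euler schemes with `i` and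
`j` steps for times `t` and `s` differ by at most `√((t-s)² + t²/i + s²/j) ‖y‖`
(`IsMAccretive.dist_euler_le`). This gives convergence and joint continuity of `S(t)x`, hence
measurability of the Duhamel integrand and continuity of the integral in `t`. -/

namespace NonlinearCauchy

/-! ### Resolvents of an m-accretive operator -/

section Resolvent

variable {X : Type*} [NormedAddCommGroup X] [NormedSpace ℝ X] {A : Set (X × X)}

theorem IsMAccretive.norm_sub_le (hA : IsMAccretive A) {x y x' y' : X} (h : (x, y) ∈ A)
    (h' : (x', y') ∈ A) {l : ℝ} (hl : 0 ≤ l) :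
    ‖x - x'‖ ≤ ‖(x + l • y) - (x' + l • y')‖ := by
  have := hA.accretive _ h _ h' l hl
  simp only [smul_sub] at this
  rwa [add_sub_add_comm]

/-- Surjectivity of `I + l A` propagates from `l₀` to all `l > l₀ / 2`. -/
theorem IsMAccretive.exists_add_smul_eq_of_lt [CompleteSpace X] (hA : IsMAccretive A) {l₀ l : ℝ}
    (hl₀ : 0 < l₀) (hl : l₀ < 2 * l)
    (h : ∀ z : X, ∃ x y, (x, y) ∈ A ∧ x + l₀ • y = z) (z : X) :
    ∃ x y, (x, y) ∈ A ∧ x + l • y = z := by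
  choose J Y hJA hJ using h
  have hlpos : 0 < l := by linarith
  set c : ℝ := l₀ / l with hc
  have hc0 : 0 < c := by positivity
  have hc2 : c < 2 := by rw [hc, div_lt_iff₀ hlpos]; exact hl
  have hcl : c * l = l₀ := by rw [hc]; field_simp
  have habs : |1 - c| < 1 := by rw [abs_lt]; constructor <;> linarith
  -- Multiplying `x + l y = z` by `c = l₀ / l` and adding `(1 - c) x` gives `x + l₀ y = c z + (1 -
  -- c) x`, so solutions are fixed points of `f`.
  let f : X → X := fun x => J (c • z + (1 - c) • x)
  have hf : ContractingWith ⟨|1 - c|, abs_nonneg _⟩ f := by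
    refine ⟨by exact_mod_cast habs, LipschitzWith.of_dist_le_mul fun x x' => ?_⟩
    have h1 := hA.norm_sub_le (hJA (c • z + (1 - c) • x)) (hJA (c • z + (1 - c) • x')) hl₀.le
    rw [hJ, hJ, add_sub_add_left_eq_sub, ← smul_sub, norm_smul, Real.norm_eq_abs] at h1
    rw [dist_eq_norm, dist_eq_norm]
    exact h1
  set x := hf.fixedPoint f
  have hx : J (c • z + (1 - c) • x) = x := hf.fixedPoint_isFixedPt
  refine ⟨x, Y (c • z + (1 - c) • x), ?_, ?_⟩
  · have := hJA (c • z + (1 - c) • x)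
    rwa [hx] at this
  · have h2 := hJ (c • z + (1 - c) • x)
    rw [hx, ← hcl] at h2
    refine smul_right_injective X hc0.ne' ?_
    simp only [smul_add, smul_smul]
    generalize Y (c • z + (1 - c) • x) = w at *
    calc c • x + (c * l) • w = (x + (c * l) • w) - (1 - c) • x := by module
      _ = c • z := by rw [h2]; module

theorem IsMAccretive.exists_add_smul_eq [CompleteSpace X] (hA : IsMAccretive A) {l : ℝ}
    (hl : 0 < l) (z : X) : ∃ x y, (x, y) ∈ A ∧ x + l • y = z := by
  have key : ∀ n : ℕ, ∀ l : ℝ, (1 / 2 : ℝ) ^ n < l →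
      ∀ z : X, ∃ x y, (x, y) ∈ A ∧ x + l • y = z := by
    intro n
    induction n with
    | zero =>
      intro l hl
      refine hA.exists_add_smul_eq_of_lt one_pos (by norm_num at hl; linarith) fun z => ?_
      obtain ⟨⟨x, y⟩, h, hz⟩ := hA.range_eq z
      exact ⟨x, y, h, by simpa using hz⟩
    | succ n ih =>
      intro l hl
      have h0 : (0 : ℝ) < (1 / 2) ^ (n + 1) := by positivity
      have h1 : ((1 : ℝ) / 2) ^ n = 2 * (1 / 2) ^ (n + 1) := by rw [pow_succ]; ring
      -- For this `l₀`, both `l₀ < 2 l` and `(1/2)^n < l₀` amount to `(1/2)^(n+1) < l`.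
      exact hA.exists_add_smul_eq_of_lt (l₀ := l + (1 / 2) ^ (n + 1)) (by linarith)
        (by linarith) (ih _ (by linarith))
  obtain ⟨n, hn⟩ := exists_pow_lt_of_lt_one hl (by norm_num : (1 / 2 : ℝ) < 1)
  exact key n l hn z

theorem IsMAccretive.resolventMap_spec [CompleteSpace X] (hA : IsMAccretive A) {l : ℝ}
    (hl : 0 < l) (z : X) :
    ∃ y, (resolventMap A l z, y) ∈ A ∧ resolventMap A l z + l • y = z := by
  have h := hA.exists_add_smul_eq hl z
  rw [resolventMap, dif_pos h]
  exact h.choose_spec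

theorem resolventMap_zero (A : Set (X × X)) (z : X) : resolventMap A 0 z = z := by
  unfold resolventMap
  split_ifs with h
  · obtain ⟨y, -, hy⟩ := h.choose_spec
    simpa using hy
  · rfl

theorem IsMAccretive.lipschitzWith_resolventMap [CompleteSpace X] (hA : IsMAccretive A) {l : ℝ}
    (hl : 0 ≤ l) : LipschitzWith 1 (resolventMap A l) := by
  refine LipschitzWith.of_dist_le_mul fun z z' => ?_
  rcases hl.eq_or_lt with rfl | hl
  · simp [resolventMap_zero]
  · obtain ⟨y, h, hy⟩ := hA.resolventMap_spec hl z
    obtain ⟨y', h', hy'⟩ := hA.resolventMap_spec hl z'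
    have := hA.norm_sub_le h h' hl.le
    rw [hy, hy'] at this
    simpa [dist_eq_norm] using this

theorem IsMAccretive.lipschitzWith_iterate_resolventMap [CompleteSpace X] (hA : IsMAccretive A)
    {l : ℝ} (hl : 0 ≤ l) (n : ℕ) : LipschitzWith 1 (resolventMap A l)^[n] := by
  simpa using (hA.lipschitzWith_resolventMap hl).iterate n

theorem IsMAccretive.norm_resolventMap_sub_le [CompleteSpace X] (hA : IsMAccretive A) {l : ℝ}
    (hl : 0 < l) {x y : X} (hxy : (x, y) ∈ A) : ‖resolventMap A l x - x‖ ≤ l * ‖y‖ := by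
  obtain ⟨w, h, hw⟩ := hA.resolventMap_spec hl x
  have := hA.norm_sub_le h hxy hl.le
  rw [hw] at this
  simpa [norm_smul, abs_of_pos hl] using this

theorem IsMAccretive.norm_iterate_resolventMap_sub_le [CompleteSpace X] (hA : IsMAccretive A)
    {l : ℝ} (hl : 0 < l) {x y : X} (hxy : (x, y) ∈ A) (n : ℕ) :
    ‖(resolventMap A l)^[n] x - x‖ ≤ n * l * ‖y‖ := by
  induction n with
  | zero => simp
  | succ n ih =>
    have h1 := (hA.lipschitzWith_iterate_resolventMap hl.le n).dist_le_mul (resolventMap A l x) x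
    have h2 := hA.norm_resolventMap_sub_le hl hxy
    have h3 := norm_sub_le_norm_sub_add_norm_sub ((resolventMap A l)^[n] (resolventMap A l x))
      ((resolventMap A l)^[n] x) x
    simp only [dist_eq_norm, NNReal.coe_one, one_mul] at h1
    rw [Function.iterate_succ_apply]
    push_cast
    linarith

/-- The comparison inequality between one implicit Euler step of length `l` and one of
length `m`. -/
theorem IsMAccretive.norm_resolventMap_sub_resolventMap_le [CompleteSpace X]
    (hA : IsMAccretive A) {l m : ℝ} (hl : 0 < l) (hm : 0 < m) (x x' : X) :
    ‖resolventMap A l x - resolventMap A m x'‖ ≤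
      m / (l + m) * ‖x - resolventMap A m x'‖ + l / (l + m) * ‖resolventMap A l x - x'‖ := by
  obtain ⟨y, h, hy⟩ := hA.resolventMap_spec hl x
  obtain ⟨y', h', hy'⟩ := hA.resolventMap_spec hm x'
  -- With this parameter, substituting `l y = x - j` and `m y' = x' - j'` turns the right-hand side
  -- into a convex combination of `x - j'` and `j - x'`.
  have key := hA.norm_sub_le h h' (l := l * m / (l + m)) (by positivity)
  set j := resolventMap A l x
  set j' := resolventMap A m x'
  have e : (j + (l * m / (l + m)) • y) - (j' + (l * m / (l + m)) • y') =
      (m / (l + m)) • (x - j') + (l / (l + m)) • (j - x') := by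
    rw [← hy, ← hy']
    match_scalars <;> field_simp <;> ring
  rw [e] at key
  refine key.trans ((norm_add_le _ _).trans (le_of_eq ?_))
  rw [norm_smul, norm_smul, Real.norm_of_nonneg (by positivity), Real.norm_of_nonneg (by positivity)]

theorem semigroup_zero (A : Set (X × X)) (x : X) : semigroup A 0 x = x := by
  have h (n : ℕ) : (resolventMap A (0 / n))^[n] x = x :=
    Function.iterate_fixed (by rw [zero_div, resolventMap_zero]) n
  simp only [semigroup, h]
  exact tendsto_const_nhds.limUnder_eq

end Resolvent

/-- Solution of the double recursive inequality satisfied by the distances of two implicit Euler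
schemes of step lengths `l` and `m`. -/
theorem le_sqrt_of_double_recursion {a : ℕ → ℕ → ℝ} {l m M : ℝ} (hl : 0 < l) (hm : 0 < m)
    (hM : 0 ≤ M) (hi : ∀ i, a i 0 ≤ i * l * M) (hj : ∀ j, a 0 j ≤ j * m * M)
    (h : ∀ i j, a (i + 1) (j + 1) ≤ m / (l + m) * a i (j + 1) + l / (l + m) * a (i + 1) j)
    (i j : ℕ) : a i j ≤ √((i * l - j * m) ^ 2 + i * l ^ 2 + j * m ^ 2) * M := by
  induction i generalizing j with
  | zero =>
    refine (hj j).trans (mul_le_mul_of_nonneg_right (Real.le_sqrt_of_sq_le ?_) hM)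
    have : (0 : ℝ) ≤ j * m ^ 2 := by positivity
    push_cast
    nlinarith
  | succ i ihi =>
    induction j with
    | zero =>
      refine (hi (i + 1)).trans (mul_le_mul_of_nonneg_right (Real.le_sqrt_of_sq_le ?_) hM)
      have : (0 : ℝ) ≤ (i + 1) * l ^ 2 := by positivity
      push_cast
      nlinarith
    | succ j ihj =>
      have hα : 0 ≤ m / (l + m) := by positivity
      have hβ : 0 ≤ l / (l + m) := by positivity
      have hαβ : m / (l + m) + l / (l + m) = 1 := by field_simp; ring
      refine (h i j).trans ?_
      have h1 := mul_le_mul_of_nonneg_left (ihi (j + 1)) hα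
      have h2 := mul_le_mul_of_nonneg_left ihj hβ
      refine (add_le_add h1 h2).trans ?_
      rw [← mul_assoc, ← mul_assoc, ← add_mul]
      refine mul_le_mul_of_nonneg_right ?_ hM
      -- The weights average the radicands at `(i, j+1)` and `(i+1, j)` exactly to the one at `(i+1,
      -- j+1)`: the squared differences gain `l m`, the other terms lose it.
      have hc := Real.strictConcaveOn_sqrt.concaveOn.2
        (x := ((i : ℝ) * l - (j + 1 : ℕ) * m) ^ 2 + i * l ^ 2 + (j + 1 : ℕ) * m ^ 2)
        (y := ((i + 1 : ℕ) * l - (j : ℝ) * m) ^ 2 + (i + 1 : ℕ) * l ^ 2 + (j : ℝ) * m ^ 2)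
        (by rw [mem_Ici]; positivity) (by rw [mem_Ici]; positivity) hα hβ hαβ
      simp only [smul_eq_mul] at hc
      refine hc.trans (le_of_eq (congrArg _ ?_))
      push_cast
      field_simp
      ring

/-! ### Convergence of the Euler scheme and continuity of the semigroup -/

section Semigroup

variable {X : Type*} [NormedAddCommGroup X] [NormedSpace ℝ X] [CompleteSpace X]
  {A : Set (X × X)}

theorem IsMAccretive.dist_iterate_resolventMap_le (hA : IsMAccretive A) {l m : ℝ} (hl : 0 ≤ l)
    (hm : 0 ≤ m) {x y : X} (hxy : (x, y) ∈ A) (i j : ℕ) :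
    dist ((resolventMap A l)^[i] x) ((resolventMap A m)^[j] x) ≤
      √((i * l - j * m) ^ 2 + i * l ^ 2 + j * m ^ 2) * ‖y‖ := by
  have hid : ∀ n : ℕ, (resolventMap A 0)^[n] x = x := fun n =>
    Function.iterate_fixed (resolventMap_zero A x) n
  rcases hl.eq_or_lt with rfl | hl
  · rcases hm.eq_or_lt with rfl | hm
    · simp [hid]
    · rw [hid, dist_comm, dist_eq_norm]
      refine (hA.norm_iterate_resolventMap_sub_le hm hxy j).trans
        (mul_le_mul_of_nonneg_right (Real.le_sqrt_of_sq_le ?_) (norm_nonneg _))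
      have : (0 : ℝ) ≤ j * m ^ 2 := by positivity
      nlinarith
  · rcases hm.eq_or_lt with rfl | hm
    · rw [hid, dist_eq_norm]
      refine (hA.norm_iterate_resolventMap_sub_le hl hxy i).trans
        (mul_le_mul_of_nonneg_right (Real.le_sqrt_of_sq_le ?_) (norm_nonneg _))
      have : (0 : ℝ) ≤ i * l ^ 2 := by positivity
      nlinarith
    · refine le_sqrt_of_double_recursion
        (a := fun i j => dist ((resolventMap A l)^[i] x) ((resolventMap A m)^[j] x))
        hl hm (norm_nonneg y) (fun i => ?_) (fun j => ?_) (fun i j => ?_) i j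
      · simpa [dist_eq_norm] using hA.norm_iterate_resolventMap_sub_le hl hxy i
      · simpa [dist_eq_norm, norm_sub_rev] using hA.norm_iterate_resolventMap_sub_le hm hxy j
      · simp only [Function.iterate_succ_apply', dist_eq_norm]
        exact hA.norm_resolventMap_sub_resolventMap_le hl hm _ _

/-- The implicit Euler approximations of two times `t` and `s`. -/
theorem IsMAccretive.dist_euler_le (hA : IsMAccretive A) {t s : ℝ} (ht : 0 ≤ t) (hs : 0 ≤ s)
    {x y : X} (hxy : (x, y) ∈ A) {i j : ℕ} (hi : i ≠ 0) (hj : j ≠ 0) :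
    dist ((resolventMap A (t / i))^[i] x) ((resolventMap A (s / j))^[j] x) ≤
      √((t - s) ^ 2 + t ^ 2 / i + s ^ 2 / j) * ‖y‖ := by
  have hi' : (i : ℝ) ≠ 0 := by exact_mod_cast hi
  have hj' : (j : ℝ) ≠ 0 := by exact_mod_cast hj
  convert hA.dist_iterate_resolventMap_le (l := t / i) (m := s / j) (by positivity)
    (by positivity) hxy i j using 4
  · field_simp
  · field_simp

theorem IsMAccretive.cauchySeq_euler_of_mem (hA : IsMAccretive A) {t : ℝ} (ht : 0 ≤ t)
    {x y : X} (hxy : (x, y) ∈ A) :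
    CauchySeq (fun n : ℕ => (resolventMap A (t / n))^[n] x) := by
  rw [cauchySeq_iff_tendsto_dist_atTop_0]
  have h0 : Tendsto (fun n : ℕ => t ^ 2 / (n : ℝ)) atTop (𝓝 0) :=
    tendsto_const_div_atTop_nhds_zero_nat _
  have h1 : Tendsto (fun n : ℕ × ℕ => √((t - t) ^ 2 + t ^ 2 / n.1 + t ^ 2 / n.2) * ‖y‖) atTop
      (𝓝 0) := by
    rw [← prod_atTop_atTop_eq]
    have h := ((((tendsto_const_nhds (x := (t - t) ^ 2)).add (h0.comp tendsto_fst)).add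
      (h0.comp (tendsto_snd (f := atTop)))).sqrt).mul_const ‖y‖
    simpa using h
  refine squeeze_zero' (Eventually.of_forall fun _ => dist_nonneg) ?_ h1
  filter_upwards [eventually_ge_atTop (1, 1)] with n hn
  exact hA.dist_euler_le ht ht hxy (Nat.one_le_iff_ne_zero.1 hn.1) (Nat.one_le_iff_ne_zero.1 hn.2)

theorem IsMAccretive.cauchySeq_euler (hA : IsMAccretive A) (hdense : Dense (domain A)) {t : ℝ}
    (ht : 0 ≤ t) (x : X) : CauchySeq (fun n : ℕ => (resolventMap A (t / n))^[n] x) := by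
  rw [Metric.cauchySeq_iff]
  intro ε hε
  obtain ⟨x', ⟨y, hxy⟩, hx'⟩ := hdense.exists_dist_lt x (by positivity : 0 < ε / 3)
  obtain ⟨N, hN⟩ := Metric.cauchySeq_iff.1 (hA.cauchySeq_euler_of_mem ht hxy) (ε / 3)
    (by positivity)
  refine ⟨N, fun m hm n hn => ?_⟩
  have hL (k : ℕ) := (hA.lipschitzWith_iterate_resolventMap (l := t / k)
    (by positivity) k).dist_le_mul x x'
  simp only [NNReal.coe_one, one_mul] at hL
  have h1 := hL m
  have h2 := hL n
  rw [dist_comm] at h2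
  have h3 := dist_triangle4 ((resolventMap A (t / m))^[m] x) ((resolventMap A (t / m))^[m] x')
    ((resolventMap A (t / n))^[n] x') ((resolventMap A (t / n))^[n] x)
  linarith [hN m hm n hn]

/-- The exponential formula of Crandall and Liggett: the implicit Euler scheme converges. -/
theorem IsMAccretive.tendsto_semigroup (hA : IsMAccretive A) (hdense : Dense (domain A)) {t : ℝ}
    (ht : 0 ≤ t) (x : X) :
    Tendsto (fun n : ℕ => (resolventMap A (t / n))^[n] x) atTop (𝓝 (semigroup A t x)) :=
  (hA.cauchySeq_euler hdense ht x).tendsto_limUnder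

theorem IsMAccretive.lipschitzWith_semigroup (hA : IsMAccretive A) (hdense : Dense (domain A))
    {t : ℝ} (ht : 0 ≤ t) : LipschitzWith 1 (semigroup A t) :=
  LipschitzWith.of_dist_le_mul fun x x' => le_of_tendsto
    ((hA.tendsto_semigroup hdense ht x).dist (hA.tendsto_semigroup hdense ht x'))
    (Eventually.of_forall fun n =>
      (hA.lipschitzWith_iterate_resolventMap (by positivity) n).dist_le_mul x x')

theorem IsMAccretive.dist_semigroup_le (hA : IsMAccretive A) (hdense : Dense (domain A))
    {t s : ℝ} (ht : 0 ≤ t) (hs : 0 ≤ s) {x y : X} (hxy : (x, y) ∈ A) :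
    dist (semigroup A t x) (semigroup A s x) ≤ ‖y‖ * dist t s := by
  have h0 (r : ℝ) : Tendsto (fun n : ℕ => r ^ 2 / (n : ℝ)) atTop (𝓝 0) :=
    tendsto_const_div_atTop_nhds_zero_nat _
  have h := ((((tendsto_const_nhds (x := (t - s) ^ 2)).add (h0 t)).add (h0 s)).sqrt).mul_const ‖y‖
  simp only [add_zero, Real.sqrt_sq_eq_abs] at h
  rw [mul_comm, Real.dist_eq]
  refine le_of_tendsto_of_tendsto
    ((hA.tendsto_semigroup hdense ht x).dist (hA.tendsto_semigroup hdense hs x)) h ?_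
  filter_upwards [eventually_ne_atTop 0] with n hn
  exact hA.dist_euler_le ht hs hxy hn hn

/-- Joint continuity of the semigroup in time and space. -/
theorem IsMAccretive.continuous_semigroup (hA : IsMAccretive A) (hdense : Dense (domain A)) :
    Continuous fun q : X × ℝ => semigroup A (max q.2 0) q.1 := by
  -- Nonexpansiveness in space, uniform in time, reduces joint continuity to continuity in time on
  -- the dense domain. Clamping at `0` avoids negative times, where no estimate is available.
  refine continuous_prod_of_dense_continuous_lipschitzWith
    (fun q : X × ℝ => semigroup A (max q.2 0) q.1) 1 hdense ?_ fun t =>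
    hA.lipschitzWith_semigroup hdense (t := max t 0) (le_max_right _ _)
  rintro x ⟨y, hxy⟩
  refine LipschitzWith.continuous (K := ‖y‖₊) (LipschitzWith.of_dist_le_mul fun t s => ?_)
  refine (hA.dist_semigroup_le hdense (le_max_right t 0) (le_max_right s 0) hxy).trans ?_
  rw [Real.dist_eq, Real.dist_eq]
  exact mul_le_mul_of_nonneg_left (abs_max_sub_max_le_abs t s 0) (norm_nonneg y)

theorem IsMAccretive.continuous_semigroup_comp (hA : IsMAccretive A) (hdense : Dense (domain A))
    {α : Type*} [TopologicalSpace α] {r : α → ℝ} (hr : Continuous r) (x : X) :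
    Continuous fun a => semigroup A (max (r a) 0) x :=
  (hA.continuous_semigroup hdense).comp (g := fun q : X × ℝ => semigroup A (max q.2 0) q.1)
    (f := fun a => (x, r a)) (continuous_const.prodMk hr)

end Semigroup
-- Superposition measurability and the weighted Hölder estimate
/-- Measurability of a superposition operator `s ↦ F (s, U s)` for a Carathéodory function `F`. -/
theorem aestronglyMeasurable_superposition {α X Y : Type*} [MeasurableSpace α] {μ : Measure α}
    [TopologicalSpace X] [TopologicalSpace Y] [TopologicalSpace.PseudoMetrizableSpace Y]
    [AddCommMonoid Y] [ContinuousAdd Y] {F : α → X → Y}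
    (hF : ∀ x, AEStronglyMeasurable (fun s => F s x) μ) (hc : ∀ᵐ s ∂μ, Continuous (F s))
    {U : α → X} (hU : StronglyMeasurable U) :
    AEStronglyMeasurable (fun s => F s (U s)) μ := by
  have hsimple (g : SimpleFunc α X) : AEStronglyMeasurable (fun s => F s (g s)) μ := by
    have : (fun s => F s (g s)) =
        fun s => ∑ x ∈ g.range, (g ⁻¹' {x}).indicator (fun s => F s x) s := by
      ext s
      rw [Finset.sum_eq_single_of_mem (g s) (g.mem_range_self s)]
      · simp
      · intro x _ hx
        exact indicator_of_notMem (fun h => hx h.symm) _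
    rw [this]
    exact Finset.aestronglyMeasurable_fun_sum _ fun x _ =>
      (hF x).indicator (g.measurableSet_fiber x)
  refine aestronglyMeasurable_of_tendsto_ae atTop (fun n => hsimple (hU.approx n)) ?_
  filter_upwards [hc] with s hs
  exact (hs.tendsto _).comp (hU.tendsto_approx s)

/-- Enlarging the interval to `(-∞, t]` makes the integral of `e^{γqs}` exactly `e^{γqt} / (γq)`. -/
theorem eLpNorm_exp_mul_le {γ q : ℝ} (hγ : 0 < γ) (hq : 0 < q) (t : ℝ) :
    eLpNorm (fun s => Real.exp (γ * s)) (ENNReal.ofReal q) (volume.restrict (Ioo 0 t)) ≤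
      ENNReal.ofReal (Real.exp (γ * t) * (γ * q) ^ (-q⁻¹)) := by
  have hγq : 0 < γ * q := by positivity
  have hsub : Ioo 0 t ⊆ Iic t := fun s hs => hs.2.le
  refine (eLpNorm_mono_measure _ (Measure.restrict_mono hsub le_rfl)).trans (le_of_eq ?_)
  rw [eLpNorm_eq_lintegral_rpow_enorm_toReal (by simpa using hq) ENNReal.ofReal_ne_top,
    ENNReal.toReal_ofReal hq.le]
  have h1 (s : ℝ) : ‖Real.exp (γ * s)‖ₑ ^ q = ENNReal.ofReal (Real.exp (γ * q * s)) := by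
    rw [Real.enorm_eq_ofReal (Real.exp_pos _).le, ENNReal.ofReal_rpow_of_nonneg
      (Real.exp_pos _).le hq.le, ← Real.exp_mul]
    ring_nf
  simp only [h1]
  rw [← ofReal_integral_eq_lintegral_ofReal (integrableOn_exp_mul_Iic hγq t)
    (Eventually.of_forall fun s => (Real.exp_pos _).le), integral_exp_mul_Iic hγq,
    ENNReal.ofReal_rpow_of_nonneg (by positivity) (by positivity)]
  congr 1
  rw [Real.div_rpow (Real.exp_pos _).le hγq.le, ← Real.exp_mul, Real.rpow_neg hγq.le,
    div_eq_mul_inv, one_div]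
  rw [show γ * q * t * q⁻¹ = γ * t by field_simp]

/-- Hölder's inequality for the convolution of `|φ|` with an exponential weight. -/
theorem integral_abs_mul_exp_le {T : ℝ} {p : ℝ≥0∞} {q : ℝ} (hq : 0 < q)
    [p.HolderConjugate (ENNReal.ofReal q)] {φ : ℝ → ℝ}
    (hφ : MemLp φ p (volume.restrict (Ioo 0 T))) {γ : ℝ} (hγ : 0 < γ) {t : ℝ} (ht : 0 ≤ t)
    (htT : t ≤ T) :
    ∫ s in (0 : ℝ)..t, |φ s| * Real.exp (γ * s) ≤
      lpNormOn T p φ * (Real.exp (γ * t) * (γ * q) ^ (-q⁻¹)) := by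
  have hle : volume.restrict (Ioo 0 t) ≤ volume.restrict (Ioo 0 T) :=
    Measure.restrict_mono (Ioo_subset_Ioo_right htT) le_rfl
  have hexp : AEStronglyMeasurable (fun s => Real.exp (γ * s)) (volume.restrict (Ioo 0 t)) :=
    (by fun_prop : Continuous fun s => Real.exp (γ * s)).aestronglyMeasurable
  have hφt := hφ.mono_measure hle
  have h1 := eLpNorm_smul_le_mul_eLpNorm (p := p) (q := ENNReal.ofReal q) (r := 1) hexp hφt.1
  have h2 : ∫ s in (0 : ℝ)..t, |φ s| * Real.exp (γ * s) =
      (eLpNorm (φ • fun s => Real.exp (γ * s)) 1 (volume.restrict (Ioo 0 t))).toReal := by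
    rw [intervalIntegral.integral_of_le ht, integral_Ioc_eq_integral_Ioo,
      eLpNorm_one_eq_lintegral_enorm, ← integral_norm_eq_lintegral_enorm (hφt.1.smul hexp)]
    simp
  rw [h2, lpNormOn, ← ENNReal.toReal_ofReal (r := Real.exp (γ * t) * (γ * q) ^ (-q⁻¹))
    (by positivity), ← ENNReal.toReal_mul]
  refine ENNReal.toReal_mono (ENNReal.mul_ne_top hφ.2.ne ENNReal.ofReal_ne_top) (h1.trans ?_)
  exact mul_le_mul' (eLpNorm_mono_measure _ hle) (eLpNorm_exp_mul_le hγ hq t)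

/-! ### Integrability and time continuity of the Duhamel term -/

section Duhamel

variable {X : Type*} [NormedAddCommGroup X]

theorem StructuralCondition.ae_norm_sub_le {T : ℝ} {K : ℝ → ℝ → ℝ} {F : ℝ → X → X} {φ : ℝ → ℝ}
    (hFK : StructuralCondition T K F)
    (hKφ : ∀ᵐ t ∂(volume.restrict (Ioo 0 T)), ∀ U : ℝ, 0 ≤ U → K t U ≤ φ t * U) :
    ∀ᵐ t ∂(volume.restrict (Ioo 0 T)), ∀ u v : X, ‖F t u - F t v‖ ≤ |φ t| * ‖u - v‖ := by
  filter_upwards [hFK.bound, hKφ] with t h1 h2 u v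
  exact (h1 u v).trans ((h2 _ (norm_nonneg _)).trans
    (mul_le_mul_of_nonneg_right (le_abs_self _) (norm_nonneg _)))

/-- The Lipschitz bound makes `F` a Carathéodory function and dominates the superposition by `‖F(s,
0)‖ + |φ(s)| ‖u‖`. -/
theorem integrableOn_superposition {T : ℝ} {F : ℝ → X → X} {φ : ℝ → ℝ}
    (hFint : ∀ x : X, IntegrableOn (fun s => F s x) (Ioo 0 T) volume)
    (hφ : IntegrableOn φ (Ioo 0 T))
    (hF : ∀ᵐ t ∂(volume.restrict (Ioo 0 T)), ∀ u v : X, ‖F t u - F t v‖ ≤ |φ t| * ‖u - v‖)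
    (hT : 0 ≤ T) (u : C(Icc (0 : ℝ) T, X)) :
    IntegrableOn (fun s => F s (IccExtend hT u s)) (Ioo 0 T) := by
  have hcont : ∀ᵐ s ∂(volume.restrict (Ioo 0 T)), Continuous (F s) := by
    filter_upwards [hF] with s hs
    exact (LipschitzWith.of_dist_le_mul (K := ‖φ s‖₊) fun x y => by
      rw [dist_eq_norm, dist_eq_norm]; exact hs x y).continuous
  have hU : Continuous (IccExtend hT u) := u.continuous.Icc_extend'
  refine Integrable.mono' ((hFint 0).norm.add (hφ.norm.mul_const ‖u‖))
    (aestronglyMeasurable_superposition (fun x => (hFint x).1) hcont hU.stronglyMeasurable) ?_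
  filter_upwards [hF] with s hs
  have h1 := hs (IccExtend hT u s) 0
  rw [sub_zero] at h1
  have h2 : ‖IccExtend hT u s‖ ≤ ‖u‖ := u.norm_coe_le_norm _
  have h3 := norm_le_norm_add_norm_sub (F s 0) (F s (IccExtend hT u s))
  have h4 := mul_le_mul_of_nonneg_left h2 (abs_nonneg (φ s))
  simp only [Pi.add_apply, Real.norm_eq_abs]
  rw [norm_sub_rev] at h3
  linarith

variable [NormedSpace ℝ X] [CompleteSpace X] {A : Set (X × X)}

/-- Provides a majorant independent of `t`, for dominated convergence. Since `S(r)0` need not vanish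
for nonlinear `A`, a bound `C` for it on `[0, T]` is added to `‖f‖`. -/
theorem IsMAccretive.integrableOn_semigroup_comp (hA : IsMAccretive A)
    (hdense : Dense (domain A)) {T : ℝ} {f : ℝ → X} (hf : IntegrableOn f (Ioo 0 T)) :
    ∃ g : ℝ → ℝ, IntegrableOn g (Ioo 0 T) ∧ ∀ t ≤ T,
      AEStronglyMeasurable (fun s => semigroup A (max (t - s) 0) (f s))
        (volume.restrict (Ioo 0 T)) ∧
      ∀ᵐ s ∂(volume.restrict (Ioo 0 T)), ‖semigroup A (max (t - s) 0) (f s)‖ ≤ g s := by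
  obtain ⟨C, hC⟩ := (isCompact_Icc (a := 0) (b := T)).exists_bound_of_continuousOn
    (f := fun r => semigroup A (max r 0) (0 : X))
    (hA.continuous_semigroup_comp hdense continuous_id 0).continuousOn
  refine ⟨fun s => ‖f s‖ + C, hf.norm.add (integrable_const C), fun t ht => ⟨?_, ?_⟩⟩
  · exact (hA.continuous_semigroup hdense).comp_aestronglyMeasurable
      (g := fun q : X × ℝ => semigroup A (max q.2 0) q.1) (f := fun s => (f s, t - s)) (hf.1.prodMk
      (by fun_prop : Continuous fun s => t - s).aestronglyMeasurable)
  · filter_upwards [ae_restrict_mem measurableSet_Ioo] with s hs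
    have h1 := (hA.lipschitzWith_semigroup hdense (le_max_right (t - s) 0)).dist_le_mul (f s) 0
    simp only [NNReal.coe_one, one_mul, dist_eq_norm, sub_zero] at h1
    have h2 := hC (max (t - s) 0) ⟨le_max_right _ _, max_le (by linarith [hs.1])
      (by linarith [hs.1, hs.2])⟩
    simp only [max_eq_left (le_max_right (t - s) 0)] at h2
    have h3 := norm_le_norm_add_norm_sub (semigroup A (max (t - s) 0) 0)
      (semigroup A (max (t - s) 0) (f s))
    rw [norm_sub_rev] at h3
    linarith

theorem IsMAccretive.intervalIntegrable_semigroup_comp_max (hA : IsMAccretive A)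
    (hdense : Dense (domain A)) {T : ℝ} {f : ℝ → X} (hf : IntegrableOn f (Ioo 0 T)) (hT : 0 ≤ T)
    {t : ℝ} (ht : t ≤ T) :
    IntervalIntegrable (fun s => semigroup A (max (t - s) 0) (f s)) volume 0 T := by
  obtain ⟨g, hg, h⟩ := hA.integrableOn_semigroup_comp hdense hf
  rw [intervalIntegrable_iff_integrableOn_Ioo_of_le hT]
  exact Integrable.mono' hg (h t ht).1 (h t ht).2

theorem IsMAccretive.intervalIntegrable_semigroup_comp (hA : IsMAccretive A)
    (hdense : Dense (domain A)) {T : ℝ} {f : ℝ → X} (hf : IntegrableOn f (Ioo 0 T))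
    {t : ℝ} (ht : t ∈ Icc 0 T) :
    IntervalIntegrable (fun s => semigroup A (t - s) (f s)) volume 0 t := by
  have h := (hA.intervalIntegrable_semigroup_comp_max hdense hf (ht.1.trans ht.2) ht.2).mono_set
    (uIcc_subset_uIcc_left (by rwa [uIcc_of_le (ht.1.trans ht.2)]))
  refine h.congr fun s hs => ?_
  rw [uIoc_of_le ht.1] at hs
  simp only [max_eq_left (sub_nonneg.2 hs.2)]

/-- The convolution of the semigroup with an integrable function is continuous. -/
theorem IsMAccretive.continuousOn_integral_semigroup_comp (hA : IsMAccretive A)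
    (hdense : Dense (domain A)) {T : ℝ} (hT : 0 ≤ T) {f : ℝ → X} (hf : IntegrableOn f (Ioo 0 T)) :
    ContinuousOn (fun t => ∫ s in (0 : ℝ)..t, semigroup A (t - s) (f s)) (Icc 0 T) := by
  -- Clamping `t - s` at `0` fixes the integration interval. As `S(0)` is the identity, the surplus
  -- is `∫ₜᵀ f`, itself continuous in `t`.
  have hdom : ContinuousOn (fun t => ∫ s in (0 : ℝ)..T, semigroup A (max (t - s) 0) (f s))
      (Icc 0 T) := by
    obtain ⟨g, hg, h⟩ := hA.integrableOn_semigroup_comp hdense hf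
    simp only [intervalIntegral.integral_of_le hT, integral_Ioc_eq_integral_Ioo]
    refine continuousOn_of_dominated (fun t ht => (h t ht.2).1) (fun t ht => (h t ht.2).2) hg ?_
    exact Eventually.of_forall fun s => (hA.continuous_semigroup_comp hdense
      (continuous_id.sub continuous_const) (f s)).continuousOn
  have hprim : ContinuousOn (fun t => ∫ s in t..T, f s) (Icc 0 T) := by
    have := intervalIntegral.continuousOn_primitive_interval_left (a := 0) (b := T) (f := f)
      (μ := volume) (by
        rw [uIcc_of_le hT, integrableOn_Icc_iff_integrableOn_Ioo]; exact hf)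
    rwa [uIcc_of_le hT] at this
  refine (hdom.sub hprim).congr fun t ht => ?_
  have hP := hA.intervalIntegrable_semigroup_comp_max hdense hf hT ht.2
  have htu : t ∈ uIcc 0 T := by rwa [uIcc_of_le hT]
  have h1 : ∫ s in (0 : ℝ)..t, semigroup A (t - s) (f s) =
      ∫ s in (0 : ℝ)..t, semigroup A (max (t - s) 0) (f s) := by
    refine intervalIntegral.integral_congr fun s hs => ?_
    rw [uIcc_of_le ht.1] at hs
    simp only [max_eq_left (sub_nonneg.2 hs.2)]
  have h2 : ∫ s in t..T, f s = ∫ s in t..T, semigroup A (max (t - s) 0) (f s) := by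
    refine intervalIntegral.integral_congr fun s hs => ?_
    rw [uIcc_of_le ht.2] at hs
    simp only [max_eq_right (sub_nonpos.2 hs.1), semigroup_zero]
  simp only [h1, Pi.sub_apply, h2]
  rw [eq_sub_iff_add_eq]
  exact intervalIntegral.integral_add_adjacent_intervals
    (hP.mono_set (uIcc_subset_uIcc_left htu)) (hP.mono_set (uIcc_subset_uIcc_right htu))

theorem IsMAccretive.continuousOn_duhamelMap (hA : IsMAccretive A)
    (hdense : Dense (domain A)) {T : ℝ} (hT : 0 ≤ T) {F : ℝ → X → X} {u : C(Icc (0 : ℝ) T, X)}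
    (hf : IntegrableOn (fun s => F s (IccExtend hT u s)) (Ioo 0 T)) (u₀ : X) :
    ContinuousOn (duhamelMap A F hT u₀ u) (Icc 0 T) := by
  refine ContinuousOn.add ?_ (hA.continuousOn_integral_semigroup_comp hdense hT hf)
  refine (hA.continuous_semigroup_comp hdense continuous_id u₀).continuousOn.congr fun t ht => ?_
  simp only [id, max_eq_left ht.1]

end Duhamel

/-! ### The Bielecki norm and the contraction estimate -/

section Bielecki

variable {X : Type*} [NormedAddCommGroup X] {T : ℝ}

theorem exp_mul_norm_le_bieleckiNorm (γ : ℝ) (u : C(Icc (0 : ℝ) T, X)) (t : Icc (0 : ℝ) T) :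
    Real.exp (-γ * t) * ‖u t‖ ≤ bieleckiNorm γ u := by
  have hc : Continuous fun t : Icc (0 : ℝ) T => Real.exp (-γ * t) * ‖u t‖ := by fun_prop
  have := (isCompact_range hc).bddAbove
  exact le_ciSup this t

theorem norm_apply_le_exp_mul_bieleckiNorm (γ : ℝ) (u : C(Icc (0 : ℝ) T, X))
    (t : Icc (0 : ℝ) T) : ‖u t‖ ≤ Real.exp (γ * t) * bieleckiNorm γ u := by
  have h := mul_le_mul_of_nonneg_left (exp_mul_norm_le_bieleckiNorm γ u t)
    (Real.exp_pos (γ * t)).le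
  rwa [← mul_assoc, ← Real.exp_add, neg_mul, add_neg_cancel, Real.exp_zero, one_mul] at h

theorem bieleckiNorm_nonneg (γ : ℝ) (u : C(Icc (0 : ℝ) T, X)) : 0 ≤ bieleckiNorm γ u :=
  Real.iSup_nonneg fun _ => by positivity

variable [NormedSpace ℝ X]

/-- Multiplication by the weight `t ↦ exp (c t)`. -/
noncomputable def expMul (c : ℝ) (u : C(Icc (0 : ℝ) T, X)) : C(Icc (0 : ℝ) T, X) :=
  ⟨fun t => Real.exp (c * t) • u t, by fun_prop⟩

theorem expMul_apply (c : ℝ) (u : C(Icc (0 : ℝ) T, X)) (t : Icc (0 : ℝ) T) :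
    expMul c u t = Real.exp (c * t) • u t := rfl

theorem expMul_sub (c : ℝ) (u v : C(Icc (0 : ℝ) T, X)) :
    expMul c (u - v) = expMul c u - expMul c v := by
  ext t
  simp [expMul_apply, smul_sub]

theorem expMul_neg_expMul (c : ℝ) (u : C(Icc (0 : ℝ) T, X)) : expMul (-c) (expMul c u) = u := by
  ext t
  rw [expMul_apply, expMul_apply, smul_smul, ← Real.exp_add]
  simp

theorem norm_expMul_neg (hT : 0 ≤ T) (γ : ℝ) (u : C(Icc (0 : ℝ) T, X)) :
    ‖expMul (-γ) u‖ = bieleckiNorm γ u := by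
  have : Nonempty (Icc (0 : ℝ) T) := ⟨⟨0, le_rfl, hT⟩⟩
  have h (t : Icc (0 : ℝ) T) : ‖expMul (-γ) u t‖ = Real.exp (-γ * t) * ‖u t‖ := by
    rw [expMul_apply, norm_smul, Real.norm_of_nonneg (Real.exp_pos _).le]
  refine le_antisymm ((ContinuousMap.norm_le _ (bieleckiNorm_nonneg γ u)).2 fun t => ?_)
    (ciSup_le fun t => ?_)
  · exact (h t).trans_le (exp_mul_norm_le_bieleckiNorm γ u t)
  · exact (h t).symm.trans_le (ContinuousMap.norm_coe_le_norm _ t)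

/-- Banach's fixed point theorem for the Bielecki norm. -/
theorem IsBieleckiContraction.existsUnique_fixedPoint [CompleteSpace X] (hT : 0 ≤ T) {γ : ℝ}
    {G : C(Icc (0 : ℝ) T, X) → C(Icc (0 : ℝ) T, X)} (hG : IsBieleckiContraction γ G) :
    ∃! u : C(Icc (0 : ℝ) T, X), G u = u := by
  obtain ⟨k, hk0, hk1, hk⟩ := hG
  have hinv (u : C(Icc (0 : ℝ) T, X)) : expMul γ (expMul (-γ) u) = u := by
    simpa using expMul_neg_expMul (-γ) u
  -- Conjugation by the weight carries the Bielecki norm to the sup norm, for which the space is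
  -- complete.
  have hH : ContractingWith ⟨k, hk0⟩ fun v => expMul (-γ) (G (expMul γ v)) := by
    refine ⟨by exact_mod_cast hk1, LipschitzWith.of_dist_le_mul fun v w => ?_⟩
    rw [dist_eq_norm, dist_eq_norm, ← expMul_sub, norm_expMul_neg hT]
    refine (hk _ _).trans (le_of_eq ?_)
    rw [← expMul_sub, ← norm_expMul_neg hT, expMul_neg_expMul]
    rfl
  refine ⟨expMul γ (hH.fixedPoint _), ?_, fun u hu => ?_⟩
  · have h := hH.fixedPoint_isFixedPt
    have h' := congrArg (expMul γ) h
    rwa [hinv] at h'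
  · have : Function.IsFixedPt (fun v => expMul (-γ) (G (expMul γ v))) (expMul (-γ) u) := by
      simp only [Function.IsFixedPt, hinv, hu]
    rw [← hH.fixedPoint_unique this, hinv]

/-- The Duhamel operator is a strict contraction for a sufficiently large Bielecki weight. -/
theorem IsMAccretive.isBieleckiContraction [CompleteSpace X] {A : Set (X × X)}
    (hA : IsMAccretive A) (hdense : Dense (domain A)) (hT : 0 ≤ T) {F : ℝ → X → X}
    {p : ℝ≥0∞} {q : ℝ} (hq : 0 < q) [p.HolderConjugate (ENNReal.ofReal q)] {φ : ℝ → ℝ}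
    (hφ : MemLp φ p (volume.restrict (Ioo 0 T)))
    (hF : ∀ᵐ t ∂(volume.restrict (Ioo 0 T)), ∀ u v : X, ‖F t u - F t v‖ ≤ |φ t| * ‖u - v‖)
    {u₀ : X} {G : C(Icc (0 : ℝ) T, X) → C(Icc (0 : ℝ) T, X)}
    (hG : ∀ (u : C(Icc (0 : ℝ) T, X)) (t : Icc (0 : ℝ) T),
        IntervalIntegrable (duhamelIntegrand A F hT u t) volume 0 t ∧
        G u t = duhamelMap A F hT u₀ u t)
    {γ : ℝ} (hγ : lpNormOn T p φ ^ q < γ * q) : IsBieleckiContraction γ G := by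
  have hN : 0 ≤ lpNormOn T p φ := ENNReal.toReal_nonneg
  have hγq : 0 < γ * q := (Real.rpow_nonneg hN q).trans_lt hγ
  have hγ0 : 0 < γ := pos_of_mul_pos_left hγq hq.le
  have hφ1 : IntegrableOn φ (Ioo 0 T) :=
    hφ.integrable (ENNReal.HolderConjugate.one_le p (ENNReal.ofReal q))
  refine ⟨lpNormOn T p φ * (γ * q) ^ (-q⁻¹), by positivity, ?_, fun u v => ?_⟩
  · rw [Real.rpow_neg hγq.le, ← div_eq_mul_inv, div_lt_one (by positivity)]
    exact (Real.lt_rpow_inv_iff_of_pos hN hγq.le hq).2 hγ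
  have : Nonempty (Icc (0 : ℝ) T) := ⟨⟨0, le_rfl, hT⟩⟩
  refine ciSup_le fun t => ?_
  set B := bieleckiNorm γ (u - v)
  have hB : 0 ≤ B := bieleckiNorm_nonneg _ _
  have hint : IntervalIntegrable (fun s => |φ s| * Real.exp (γ * s)) volume 0 t := by
    refine IntervalIntegrable.mul_continuousOn ?_ (by fun_prop)
    rw [intervalIntegrable_iff_integrableOn_Ioo_of_le t.2.1]
    exact (hφ1.mono_set (Ioo_subset_Ioo_right t.2.2)).abs
  have hbound : ∀ᵐ s ∂volume, s ∈ Ioc 0 (t : ℝ) →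
      ‖duhamelIntegrand A F hT u t s - duhamelIntegrand A F hT v t s‖ ≤
        |φ s| * Real.exp (γ * s) * B := by
    -- The bound on `F` holds on the open interval, while `s = T` can occur here when `t = T`.
    have hne : ∀ᵐ s : ℝ ∂volume, s ≠ T := by simp [ae_iff]
    filter_upwards [(ae_restrict_iff' measurableSet_Ioo).1 hF, hne] with s hs hsT hst
    have hs' : s ∈ Icc 0 T := ⟨hst.1.le, hst.2.trans t.2.2⟩
    have h1 := (hA.lipschitzWith_semigroup hdense (sub_nonneg.2 hst.2)).dist_le_mul
      (F s (IccExtend hT u s)) (F s (IccExtend hT v s))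
    simp only [NNReal.coe_one, one_mul, dist_eq_norm] at h1
    refine h1.trans ((hs ⟨hst.1, lt_of_le_of_ne hs'.2 hsT⟩ _ _).trans ?_)
    rw [IccExtend_of_mem hT u hs', IccExtend_of_mem hT v hs', mul_assoc]
    exact mul_le_mul_of_nonneg_left (norm_apply_le_exp_mul_bieleckiNorm γ (u - v) ⟨s, hs'⟩)
      (abs_nonneg _)
  have hdiff : ‖(G u - G v) t‖ ≤
      lpNormOn T p φ * (Real.exp (γ * t) * (γ * q) ^ (-q⁻¹)) * B := by
    rw [ContinuousMap.sub_apply, (hG u t).2, (hG v t).2, duhamelMap, duhamelMap,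
      add_sub_add_left_eq_sub, ← intervalIntegral.integral_sub (hG u t).1 (hG v t).1]
    refine (intervalIntegral.norm_integral_le_of_norm_le t.2.1 hbound (hint.mul_const B)).trans ?_
    rw [intervalIntegral.integral_mul_const]
    exact mul_le_mul_of_nonneg_right (integral_abs_mul_exp_le hq hφ hγ0 t.2.1 t.2.2) hB
  refine (mul_le_mul_of_nonneg_left hdiff (Real.exp_pos _).le).trans (le_of_eq ?_)
  have hexp : Real.exp (-γ * t) * Real.exp (γ * t) = 1 := by
    rw [← Real.exp_add]; simp
  linear_combination (lpNormOn T p φ * (γ * q) ^ (-q⁻¹) * B) * hexp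

end Bielecki

end NonlinearCauchy

/-! ### The fixed point theorem for the Duhamel operator -/

theorem corollary3p1 {X : Type*} [NormedAddCommGroup X] [NormedSpace ℝ X] [CompleteSpace X]
    (A : Set (X × X)) (hA : NonlinearCauchy.IsMAccretive A)
    (hdense : Dense (NonlinearCauchy.domain A))
    (T : ℝ) (hT : 0 < T) (F : ℝ → X → X) (K : ℝ → ℝ → ℝ)
    (hFint : ∀ x : X, IntegrableOn (fun s => F s x) (Ioo 0 T) volume)
    (hFK : NonlinearCauchy.StructuralCondition T K F)
    (p : ℝ≥0∞) (hp : 1 < p) (φ : ℝ → ℝ) (hφ : MemLp φ p (volume.restrict (Ioo 0 T)))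
    (hKφ : ∀ᵐ t ∂(volume.restrict (Ioo 0 T)), ∀ U : ℝ, 0 ≤ U → K t U ≤ φ t * U)
    (u₀ : X) :
    ∃ G : C(Icc (0 : ℝ) T, X) → C(Icc (0 : ℝ) T, X),
      (∀ (u : C(Icc (0 : ℝ) T, X)) (t : Icc (0 : ℝ) T),
        IntervalIntegrable (NonlinearCauchy.duhamelIntegrand A F hT.le u t) volume 0 t ∧
        G u t = NonlinearCauchy.duhamelMap A F hT.le u₀ u t) ∧
      (p ≠ ∞ → ∀ γ : ℝ,
        (p.toReal - 1) / p.toReal *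
            NonlinearCauchy.lpNormOn T p φ ^ (p.toReal / (p.toReal - 1)) < γ →
        NonlinearCauchy.IsBieleckiContraction γ G) ∧
      (p = ∞ → ∀ γ : ℝ, NonlinearCauchy.lpNormOn T ∞ φ < γ →
        NonlinearCauchy.IsBieleckiContraction γ G) ∧
      ∃! u : C(Icc (0 : ℝ) T, X), G u = u := by
  have hF := hFK.ae_norm_sub_le hKφ
  have hint (u : C(Icc (0 : ℝ) T, X)) :=
    NonlinearCauchy.integrableOn_superposition hFint (hφ.integrable hp.le) hF hT.le u
  let G (u : C(Icc (0 : ℝ) T, X)) : C(Icc (0 : ℝ) T, X) :=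
    ⟨(Icc 0 T).domRestrict (NonlinearCauchy.duhamelMap A F hT.le u₀ u),
      (hA.continuousOn_duhamelMap hdense hT.le (hint u) u₀).domRestrict⟩
  have hG (u : C(Icc (0 : ℝ) T, X)) (t : Icc (0 : ℝ) T) :
      IntervalIntegrable (NonlinearCauchy.duhamelIntegrand A F hT.le u t) volume 0 t ∧
        G u t = NonlinearCauchy.duhamelMap A F hT.le u₀ u t :=
    ⟨hA.intervalIntegrable_semigroup_comp hdense (hint u) t.2, rfl⟩
  have hfin : p ≠ ∞ → ∀ γ : ℝ, (p.toReal - 1) / p.toReal *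
      NonlinearCauchy.lpNormOn T p φ ^ (p.toReal / (p.toReal - 1)) < γ →
      NonlinearCauchy.IsBieleckiContraction γ G := by
    intro hp' γ hγ
    have hp1 : 1 < p.toReal := by
      rwa [← ENNReal.toReal_one, ENNReal.toReal_lt_toReal ENNReal.one_ne_top hp']
    have hc := Real.HolderConjugate.conjExponent hp1
    have hq : 0 < p.toReal / (p.toReal - 1) := div_pos (by linarith) (by linarith)
    have : p.HolderConjugate (ENNReal.ofReal (p.toReal / (p.toReal - 1))) := by
      have := hc.ennrealOfReal
      rwa [ENNReal.ofReal_toReal hp'] at this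
    refine hA.isBieleckiContraction hdense hT.le hq hφ hF hG ?_
    rw [div_mul_eq_mul_div, div_lt_iff₀ (by linarith)] at hγ
    rw [mul_div_assoc', lt_div_iff₀ (by linarith)]
    linarith
  have hinf : p = ∞ → ∀ γ : ℝ, NonlinearCauchy.lpNormOn T ∞ φ < γ →
      NonlinearCauchy.IsBieleckiContraction γ G := by
    rintro rfl γ hγ
    have : (∞ : ℝ≥0∞).HolderConjugate (ENNReal.ofReal 1) := by
      rw [ENNReal.ofReal_one]; infer_instance
    exact hA.isBieleckiContraction hdense hT.le one_pos hφ hF hG (by simpa using hγ)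
  refine ⟨G, hG, hfin, hinf, ?_⟩
  -- Any admissible weight suffices, for instance the threshold plus one.
  by_cases hp' : p = ∞
  · exact (hinf hp' _ (lt_add_one _)).existsUnique_fixedPoint hT.le
  · exact (hfin hp' _ (lt_add_one _)).existsUnique_fixedPoint hT.le
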